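/- Conventions. An inverse monoid $S$ is $X$-generated via a map $\iota_S\colon X\to S$ (not necessarily injective) if it is generated by $\iota_S(X)$ in the signature $(\cdot,1,{}^{-1})$; for a word $w\in(X\cup X^{-1})^*$, $w_S$ denotes its value in $S$. A homomorphism between $X$-generated structures is canonical if it respects the maps from $X$. Let $\sigma$ be the least group congruence of $S$; $S$ is $E$-unitary if the $\sigma$-class of $1$ is the set of idempotents of $S$. The greatest group image $G=S/\sigma$ is $X$-generated via the composite $X\to S\to G$. The Cayley graph of an $X$-generated inverse monoid (or group) $M$ has vertex set $M$ and an edge labelled $x$ from $m$ to $m x_M$ for all $m\in M$, $x\in X\cup X^{-1}$. Let $\Gamma_X$ be the Cayley graph of the group $G$ and $\operatorname{CSub}\Gamma_X$ the poset, under inclusion, of its connected (in particular non-empty) subgraphs, where subgraphs are closed under end points and inverses of edges. For an $E$-unitary $S$, the Schützenberger graph $S\Gamma(s)$, i.e. the strong component of $s$ in the Cayley graph of $S$, is viewed as a subgraph of $\Gamma_X$ via $t\mapsto t\sigma$. A closure operator $()^c$ on $\operatorname{CSub}\Gamma_X$ is $G$-invariant if $(g\Delta)^c=g(\Delta^c)$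 for all $g\in G$ and all $\Delta$, and finitary if $\Delta^c=\bigcup\{F^c: F\subseteq\Delta \text{ finite connected}\}$ for all $\Delta$; a subgraph is compact if it is of the form $F^c$ with $F$ finite and connected. For an $X$-generated $E$-unitary inverse monoid $S$ with greatest group image $G$, let $()^{c_S}$ be the ($G$-invariant) closure operator on $\operatorname{CSub}\Gamma_X$ whose closed elements are those $\Delta$ such that, for all words $u,v$ with $u_S=v_S$ and all vertices $g,h$ of $\Delta$, $u$ labels a path from $g$ to $h$ in $\Delta$ if and only if $v$ does. For an $X$-generated group $G$ and a $G$-invariant closure operator $()^c$ on $\operatorname{CSub}\Gamma_X$, let $S_c$ be the inverse monoid of all pairs $(\Delta,g)$ with $g\in G$ and $\Delta\in\operatorname{CSub}\Gamma_X$ compact and containing $1$ and $g$, with operations $(\Delta,g)(\Xi,h)=((\Delta\cup g\Xi)^c,gh)$ and $(\Delta,g)^{-1}=(g^{-1}\Delta,g^{-1})$, together with the map $X\to S_c$, $x\mapsto(\langle\overline x\rangle^c,x_G)$, where $\langle\overline x\rangle$ is the subgraph spanned by the edge labelled $x$ starting at $1$. Proposition. (1) For any $X$-generated $E$-unitary inverse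 monoid $S$ with greatest group image $G$, the map $\psi\colon S\to S_{c_S}$, $s\mapsto(S\Gamma(s),s\sigma)$, is a (well-defined) canonical isomorphism. (2) For any $X$-generated group $G$ and any $G$-invariant, finitary closure operator $()^c$ on $\operatorname{CSub}\Gamma_X$, the inverse monoid $S_c$ is $X$-generated and $E$-unitary with greatest group image $G$ (via $(\Delta,g)\mapsto g$), and $()^c=()^{c_{S_c}}$. -/

import Mathlib

/-- An inverse monoid: every `a` has exactly one inverse, written `a⁻¹`, i.e. exactly one `b` with
`a * b * a = a` and `b * a * b = b`. -/
class InverseMonoid (S : Type*) extends Monoid S, Inv S where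
  mul_inv_mul : ∀ a : S, a * a⁻¹ * a = a
  inv_mul_inv : ∀ a : S, a⁻¹ * a * a⁻¹ = a⁻¹
  inv_unique : ∀ a b : S, a * b * a = a → b * a * b = b → b = a⁻¹

namespace InverseMonoid

variable {S : Type*} [InverseMonoid S]

/-- The least group congruence `σ` of an inverse monoid: `s σ t` iff `es = et` for some
idempotent `e`. -/
def Sigma (s t : S) : Prop := ∃ e : S, IsIdempotentElem e ∧ e * s = e * t

/-- `S` is `E`-unitary: the projection onto `S/σ` is idempotent pure, i.e. the `σ`-class of `1`
consists of the idempotents of `S`. -/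
def IsEUnitary (S : Type*) [InverseMonoid S] : Prop :=
  ∀ s : S, Sigma s 1 ↔ IsIdempotentElem s

/-- `φ : S → G` exhibits the group `G` as the greatest group image `S/σ` of `S`
(so that `φ s` is the `σ`-class of `s`). -/
def IsGreatestGroupImage {G : Type*} [Group G] (φ : S →* G) : Prop :=
  Function.Surjective φ ∧ ∀ s t : S, φ s = φ t ↔ Sigma s t

/-- `S` is `X`-generated, as an inverse monoid, via the (not necessarily injective) map `ι`. -/
def Generates {X : Type*} (ι : X → S) : Prop :=
  ∀ T : Submonoid S, (∀ x, ι x ∈ T) → (∀ s ∈ T, s⁻¹ ∈ T) → ∀ s, s ∈ T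

theorem inv_inv' (a : S) : (a⁻¹)⁻¹ = a :=
  (inv_unique a⁻¹ a (inv_mul_inv a) (mul_inv_mul a)).symm

theorem idem_mul_inv (a : S) : a * a⁻¹ * (a * a⁻¹) = a * a⁻¹ := by
  rw [← mul_assoc, mul_inv_mul]

theorem idem_inv_mul (a : S) : a⁻¹ * a * (a⁻¹ * a) = a⁻¹ * a := by
  rw [← mul_assoc, inv_mul_inv]

theorem idem_mul {e f : S} (he : e * e = e) (hf : f * f = f) : e * f * (e * f) = e * f := by
  have he' : ∀ z : S, e * (e * z) = e * z := fun z => by rw [← mul_assoc, he]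
  have hf' : ∀ z : S, f * (f * z) = f * z := fun z => by rw [← mul_assoc, hf]
  have h1 := mul_inv_mul (e * f)
  have h2 := inv_mul_inv (e * f)
  set x := (e * f)⁻¹ with hx
  have h2' : ∀ z, x * (e * (f * (x * z))) = x * z := fun z => by
    have := congrArg (· * z) h2
    simpa [mul_assoc] using this
  simp only [mul_assoc] at h1 h2
  have h3 : f * x * e = x := by
    refine inv_unique (e * f) (f * x * e) ?_ ?_
    · simp only [mul_assoc, he', hf', h1]
    · simp only [mul_assoc, he', hf', h2']
  have h4 : x * x = x := by
    conv_lhs => rw [← h3]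
    simp only [mul_assoc, h2']
    simpa [mul_assoc] using h3
  have h5 : x = x⁻¹ := inv_unique x x (by rw [h4, h4]) (by rw [h4, h4])
  have h6 : e * f = x⁻¹ := by
    refine inv_unique x (e * f) ?_ ?_
    · simpa [mul_assoc] using h2
    · simpa [mul_assoc] using h1
  rw [h6, ← h5, h4]

theorem idem_comm {e f : S} (he : e * e = e) (hf : f * f = f) : e * f = f * e := by
  have he' : ∀ z : S, e * (e * z) = e * z := fun z => by rw [← mul_assoc, he]
  have hf' : ∀ z : S, f * (f * z) = f * z := fun z => by rw [← mul_assoc, hf]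
  have h1 := idem_mul he hf
  have h2 := idem_mul hf he
  simp only [mul_assoc] at h1 h2
  have h3 : f * e = (e * f)⁻¹ := inv_unique (e * f) (f * e)
    (by simp only [mul_assoc, he', hf', h1]) (by simp only [mul_assoc, he', hf', h2])
  have h4 : e * f = (e * f)⁻¹ := inv_unique (e * f) (e * f)
    (by simp only [mul_assoc, h1]) (by simp only [mul_assoc, h1])
  rw [h3, ← h4]

/-- If `t` and `tx` lie in the same strong component of the Cayley graph, then the edge from `t`
to `tx` is reversed by the edge from `tx` labelled `x⁻¹`. -/
theorem mul_mul_inv_of_return {t x y : S} (h : t * x * y = t) : t * x * x⁻¹ = t := by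
  have hc := idem_comm (idem_inv_mul t) (idem_mul_inv x)
  have hz : x * x⁻¹ * (x * y) = x * y := by rw [← mul_assoc, mul_inv_mul]
  have ht : t * (t⁻¹ * t) = t := by rw [← mul_assoc, mul_inv_mul]
  have hf : t⁻¹ * t * (x * y) = t⁻¹ * t := by
    rw [mul_assoc, ← mul_assoc t, h]
  calc t * x * x⁻¹ = t * (t⁻¹ * t) * (x * x⁻¹) := by rw [ht, mul_assoc]
    _ = t * (x * x⁻¹ * (t⁻¹ * t)) := by rw [mul_assoc, hc]
    _ = t * (x * x⁻¹ * (t⁻¹ * t * (x * y))) := by rw [hf]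
    _ = t * (x * x⁻¹ * (t⁻¹ * t) * (x * y)) := by simp only [mul_assoc]
    _ = t * (t⁻¹ * t * (x * x⁻¹) * (x * y)) := by rw [hc]
    _ = t * (t⁻¹ * t) * (x * x⁻¹ * (x * y)) := by simp only [mul_assoc]
    _ = t := by rw [ht, hz, ← mul_assoc, h]

theorem map_inv' {G : Type*} [Group G] (φ : S →* G) (a : S) : φ a⁻¹ = (φ a)⁻¹ := by
  have h := congrArg φ (mul_inv_mul a)
  rw [map_mul, map_mul] at h
  exact (inv_eq_of_mul_eq_one_right (mul_eq_right.mp h)).symm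

end InverseMonoid

namespace XGraph

open InverseMonoid

/-! ### Words over `X ∪ X⁻¹` -/

/-- Letters of `X ∪ X⁻¹`: `(x, true)` stands for `x` and `(x, false)` for `x⁻¹`. -/
abbrev Letter (X : Type*) := X × Bool

/-- The free monoid with involution `(X ∪ X⁻¹)*`. -/
abbrev Word (X : Type*) := List (Letter X)

/-- The formal inverse of a letter. -/
def Letter.flip {X : Type*} (a : Letter X) : Letter X := (a.1, !a.2)

/-- The value of a letter in an `X`-generated inverse monoid (or group). -/
def letterVal {X M : Type*} [Inv M] (ι : X → M) (a : Letter X) : M :=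
  if a.2 then ι a.1 else (ι a.1)⁻¹

/-- The value `w_M` of a word in an `X`-generated inverse monoid (or group) `M`. -/
def wordVal {X M : Type*} [Monoid M] [Inv M] (ι : X → M) (w : Word X) : M :=
  (w.map (letterVal ι)).prod

section words

variable {X M : Type*}

@[simp] theorem flip_flip (a : Letter X) : a.flip.flip = a := by
  simp [Letter.flip]

@[simp] theorem wordVal_nil [Monoid M] [Inv M] (ι : X → M) : wordVal ι [] = 1 := rfl

@[simp] theorem wordVal_cons [Monoid M] [Inv M] (ι : X → M) (a : Letter X) (w : Word X) :
    wordVal ι (a :: w) = letterVal ι a * wordVal ι w := by simp [wordVal]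

@[simp] theorem wordVal_append [Monoid M] [Inv M] (ι : X → M) (u w : Word X) :
    wordVal ι (u ++ w) = wordVal ι u * wordVal ι w := by simp [wordVal]

@[simp] theorem letterVal_flip {G : Type*} [Group G] (ι : X → G) (a : Letter X) :
    letterVal ι a.flip = (letterVal ι a)⁻¹ := by
  rcases a with ⟨x, _ | _⟩ <;> simp [letterVal, Letter.flip]

theorem letterVal_flip' {S : Type*} [InverseMonoid S] (ι : X → S) (a : Letter X) :
    letterVal ι a.flip = (letterVal ι a)⁻¹ := by
  rcases a with ⟨x, _ | _⟩ <;> simp [letterVal, Letter.flip, inv_inv']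

theorem map_letterVal {S G : Type*} [InverseMonoid S] [Group G] {ιS : X → S} {ι : X → G}
    {φ : S →* G} (h : ∀ x, φ (ιS x) = ι x) (a : Letter X) :
    φ (letterVal ιS a) = letterVal ι a := by
  rcases a with ⟨x, _ | _⟩ <;> simp [letterVal, map_inv', h]

theorem map_wordVal {S G : Type*} [InverseMonoid S] [Group G] {ιS : X → S} {ι : X → G}
    {φ : S →* G} (h : ∀ x, φ (ιS x) = ι x) (w : Word X) :
    φ (wordVal ιS w) = wordVal ι w := by
  induction w with
  | nil => simp
  | cons a w ih => simp [map_letterVal h, ih]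

end words

/-! ### Subgraphs of the Cayley graph of a group -/

variable {X G : Type*} [Group G]

/-- A subgraph of the Cayley graph of the group `G` with respect to `ι : X → G`. The Cayley graph
has vertex set `G` and, for each `g : G` and each letter `a`, one edge `(g, a)` from `g` to
`g * a_G` labelled `a`; the inverse of this edge is `(g * a_G, a⁻¹)`. -/
@[ext]
structure Subgr (ι : X → G) where
  verts : Set G
  edges : Set (G × Letter X)
  src_mem : ∀ g a, (g, a) ∈ edges → g ∈ verts
  tgt_mem : ∀ g a, (g, a) ∈ edges → g * letterVal ι a ∈ verts
  inv_mem : ∀ g a, (g, a) ∈ edges → (g * letterVal ι a, a.flip) ∈ edges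

namespace Subgr

variable {ι : X → G}

/-- Subgraphs are ordered by inclusion; the join is the union. -/
instance : SemilatticeSup (Subgr ι) where
  le Δ Ξ := Δ.verts ⊆ Ξ.verts ∧ Δ.edges ⊆ Ξ.edges
  le_refl Δ := ⟨subset_rfl, subset_rfl⟩
  le_trans _ _ _ h h' := ⟨h.1.trans h'.1, h.2.trans h'.2⟩
  le_antisymm _ _ h h' := Subgr.ext (h.1.antisymm h'.1) (h.2.antisymm h'.2)
  sup Δ Ξ :=
    { verts := Δ.verts ∪ Ξ.verts
      edges := Δ.edges ∪ Ξ.edges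
      src_mem := fun g a h => h.imp (Δ.src_mem g a) (Ξ.src_mem g a)
      tgt_mem := fun g a h => h.imp (Δ.tgt_mem g a) (Ξ.tgt_mem g a)
      inv_mem := fun g a h => h.imp (Δ.inv_mem g a) (Ξ.inv_mem g a) }
  le_sup_left _ _ := ⟨Set.subset_union_left, Set.subset_union_left⟩
  le_sup_right _ _ := ⟨Set.subset_union_right, Set.subset_union_right⟩
  sup_le _ _ _ h h' := ⟨Set.union_subset h.1 h'.1, Set.union_subset h.2 h'.2⟩

/-- The intersection of a set of subgraphs (the whole Cayley graph if the set is empty). -/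
def inter (Y : Set (Subgr ι)) : Subgr ι where
  verts := {g | ∀ Δ ∈ Y, g ∈ Δ.verts}
  edges := {e | ∀ Δ ∈ Y, e ∈ Δ.edges}
  src_mem g a h Δ hΔ := Δ.src_mem g a (h Δ hΔ)
  tgt_mem g a h Δ hΔ := Δ.tgt_mem g a (h Δ hΔ)
  inv_mem g a h Δ hΔ := Δ.inv_mem g a (h Δ hΔ)

theorem le_inter {Y : Set (Subgr ι)} {Δ : Subgr ι} : Δ ≤ inter Y ↔ ∀ Ξ ∈ Y, Δ ≤ Ξ :=
  ⟨fun h Ξ hΞ => ⟨fun _ hv => h.1 hv Ξ hΞ, fun _ he => h.2 he Ξ hΞ⟩,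
    fun h => ⟨fun _ hv Ξ hΞ => (h Ξ hΞ).1 hv, fun _ he Ξ hΞ => (h Ξ hΞ).2 he⟩⟩

/-- The left translate `gΔ`. -/
instance : SMul G (Subgr ι) where
  smul g Δ :=
    { verts := {v | g⁻¹ * v ∈ Δ.verts}
      edges := {e | (g⁻¹ * e.1, e.2) ∈ Δ.edges}
      src_mem := fun v a h => Δ.src_mem _ a h
      tgt_mem := fun v a h => by simpa [mul_assoc] using Δ.tgt_mem _ a h
      inv_mem := fun v a h => by simpa [mul_assoc] using Δ.inv_mem _ a h }

theorem mem_smul_verts {g v : G} {Δ : Subgr ι} : v ∈ (g • Δ).verts ↔ g⁻¹ * v ∈ Δ.verts := Iff.rfl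

theorem mem_smul_edges {g : G} {e : G × Letter X} {Δ : Subgr ι} :
    e ∈ (g • Δ).edges ↔ (g⁻¹ * e.1, e.2) ∈ Δ.edges := Iff.rfl

instance : MulAction G (Subgr ι) where
  one_smul Δ := by ext <;> simp [mem_smul_verts, mem_smul_edges]
  mul_smul g h Δ := by ext <;> simp [mem_smul_verts, mem_smul_edges, mul_assoc]

theorem smul_mono {g : G} {Δ Ξ : Subgr ι} (h : Δ ≤ Ξ) : g • Δ ≤ g • Ξ :=
  ⟨fun _ hv => h.1 hv, fun _ he => h.2 he⟩

theorem smul_le_iff {g : G} {Δ Ξ : Subgr ι} : g • Δ ≤ Ξ ↔ Δ ≤ g⁻¹ • Ξ :=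
  ⟨fun h => by simpa using smul_mono (g := g⁻¹) h, fun h => by simpa using smul_mono (g := g) h⟩

/-- The subgraph consisting of a single vertex. -/
def single (ι : X → G) (g : G) : Subgr ι where
  verts := {g}
  edges := ∅
  src_mem _ _ h := h.elim
  tgt_mem _ _ h := h.elim
  inv_mem _ _ h := h.elim

/-- The subgraph consisting of the edge `(g, a)`, its inverse, and their end points. -/
def edge (ι : X → G) (g : G) (a : Letter X) : Subgr ι where
  verts := {g, g * letterVal ι a}
  edges := {(g, a), (g * letterVal ι a, a.flip)}
  src_mem := by rintro _ _ (h | h) <;> cases h <;> simp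
  tgt_mem := by rintro _ _ (h | h) <;> cases h <;> simp
  inv_mem := by rintro _ _ (h | h) <;> cases h <;> simp

/-- The subgraph `⟨g w̄⟩` spanned by the path that starts at `g` and is labelled `w`. -/
def span (ι : X → G) : G → Word X → Subgr ι
  | g, [] => single ι g
  | g, a :: w => edge ι g a ⊔ span ι (g * letterVal ι a) w

/-- In the subgraph `Δ`, the word `w` labels a path from `g` to `h`. -/
def HasPath (Δ : Subgr ι) (g : G) (w : Word X) (h : G) : Prop :=
  g * wordVal ι w = h ∧ span ι g w ≤ Δ

/-- `Δ` is connected (in particular, non-empty). -/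
def IsConnected (Δ : Subgr ι) : Prop :=
  Δ.verts.Nonempty ∧ ∀ g ∈ Δ.verts, ∀ h ∈ Δ.verts, ∃ w, Δ.HasPath g w h

/-- `Δ` has finitely many vertices and edges. -/
def IsFinite (Δ : Subgr ι) : Prop := Δ.verts.Finite ∧ Δ.edges.Finite

theorem single_le {g : G} {Δ : Subgr ι} : single ι g ≤ Δ ↔ g ∈ Δ.verts :=
  ⟨fun h => h.1 rfl, fun h => ⟨by rintro _ rfl; exact h, fun _ h => h.elim⟩⟩

theorem edge_le {g : G} {a : Letter X} {Δ : Subgr ι} : edge ι g a ≤ Δ ↔ (g, a) ∈ Δ.edges := by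
  refine ⟨fun h => h.2 (Or.inl rfl), fun h => ⟨?_, ?_⟩⟩
  · rintro _ (rfl | rfl)
    exacts [Δ.src_mem _ _ h, Δ.tgt_mem _ _ h]
  · rintro _ (rfl | rfl)
    exacts [h, Δ.inv_mem _ _ h]

theorem src_mem_span (g : G) (w : Word X) : g ∈ (span ι g w).verts := by
  cases w with
  | nil => exact rfl
  | cons a w => exact Or.inl (Or.inl rfl)

theorem hasPath_nil {Δ : Subgr ι} {g h : G} : Δ.HasPath g [] h ↔ g = h ∧ g ∈ Δ.verts := by
  simp [HasPath, span, single_le]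

theorem hasPath_cons {Δ : Subgr ι} {g h : G} {a : Letter X} {w : Word X} :
    Δ.HasPath g (a :: w) h ↔ (g, a) ∈ Δ.edges ∧ Δ.HasPath (g * letterVal ι a) w h := by
  simp only [HasPath, span, sup_le_iff, edge_le, wordVal_cons, mul_assoc]
  tauto

theorem HasPath.mono {Δ Ξ : Subgr ι} (hle : Δ ≤ Ξ) {g h : G} {w : Word X}
    (hp : Δ.HasPath g w h) : Ξ.HasPath g w h := ⟨hp.1, hp.2.trans hle⟩

theorem HasPath.src {Δ : Subgr ι} {g h : G} {w : Word X} (hp : Δ.HasPath g w h) :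
    g ∈ Δ.verts := hp.2.1 (src_mem_span g w)

theorem HasPath.trans {Δ : Subgr ι} {g h k : G} {u w : Word X} (hu : Δ.HasPath g u h)
    (hw : Δ.HasPath h w k) : Δ.HasPath g (u ++ w) k := by
  induction u generalizing g with
  | nil => obtain ⟨rfl, -⟩ := hasPath_nil.mp hu; exact hw
  | cons a u ih =>
    rw [List.cons_append, hasPath_cons]
    exact ⟨(hasPath_cons.mp hu).1, ih (hasPath_cons.mp hu).2⟩

theorem HasPath.symm {Δ : Subgr ι} {g h : G} {w : Word X} (hp : Δ.HasPath g w h) :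
    ∃ u, Δ.HasPath h u g := by
  induction w generalizing g with
  | nil =>
    obtain ⟨rfl, hg⟩ := hasPath_nil.mp hp
    exact ⟨[], hasPath_nil.mpr ⟨rfl, hg⟩⟩
  | cons a w ih =>
    obtain ⟨he, hp⟩ := hasPath_cons.mp hp
    obtain ⟨u, hu⟩ := ih hp
    refine ⟨u ++ [a.flip], hu.trans (hasPath_cons.mpr ⟨Δ.inv_mem _ _ he, ?_⟩)⟩
    simpa [hasPath_nil] using Δ.src_mem _ _ he

theorem HasPath.tgt {Δ : Subgr ι} {g h : G} {w : Word X} (hp : Δ.HasPath g w h) :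
    h ∈ Δ.verts := hp.symm.choose_spec.src

theorem isConnected_of_base {Δ : Subgr ι} (g : G) (hg : g ∈ Δ.verts)
    (h : ∀ k ∈ Δ.verts, ∃ w, Δ.HasPath g w k) : Δ.IsConnected := by
  refine ⟨⟨g, hg⟩, fun a ha b hb => ?_⟩
  obtain ⟨u, hu⟩ := h a ha
  obtain ⟨v, hv⟩ := h b hb
  obtain ⟨u', hu'⟩ := hu.symm
  exact ⟨_, hu'.trans hv⟩

theorem IsConnected.sup {Δ Ξ : Subgr ι} (hΔ : Δ.IsConnected) (hΞ : Ξ.IsConnected)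
    (h : (Δ.verts ∩ Ξ.verts).Nonempty) : (Δ ⊔ Ξ).IsConnected := by
  obtain ⟨g, hg, hg'⟩ := h
  refine isConnected_of_base g (Or.inl hg) ?_
  rintro k (hk | hk)
  · obtain ⟨w, hw⟩ := hΔ.2 g hg k hk
    exact ⟨w, hw.mono le_sup_left⟩
  · obtain ⟨w, hw⟩ := hΞ.2 g hg' k hk
    exact ⟨w, hw.mono le_sup_right⟩

theorem isConnected_single (g : G) : (single ι g).IsConnected :=
  isConnected_of_base g rfl (by rintro _ rfl; exact ⟨[], hasPath_nil.mpr ⟨rfl, rfl⟩⟩)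

theorem isConnected_edge (g : G) (a : Letter X) : (edge ι g a).IsConnected := by
  refine isConnected_of_base g (Or.inl rfl) ?_
  rintro _ (rfl | rfl)
  · exact ⟨[], hasPath_nil.mpr ⟨rfl, Or.inl rfl⟩⟩
  · exact ⟨[a], hasPath_cons.mpr ⟨Or.inl rfl, hasPath_nil.mpr ⟨rfl, Or.inr rfl⟩⟩⟩

theorem isConnected_span (g : G) (w : Word X) : (span ι g w).IsConnected := by
  induction w generalizing g with
  | nil => exact isConnected_single g
  | cons a w ih => exact (isConnected_edge g a).sup (ih _) ⟨_, Or.inr rfl, src_mem_span _ w⟩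

theorem IsFinite.sup {Δ Ξ : Subgr ι} (hΔ : Δ.IsFinite) (hΞ : Ξ.IsFinite) : (Δ ⊔ Ξ).IsFinite :=
  ⟨hΔ.1.union hΞ.1, hΔ.2.union hΞ.2⟩

theorem isFinite_span (g : G) (w : Word X) : (span ι g w).IsFinite := by
  induction w generalizing g with
  | nil => exact ⟨Set.finite_singleton g, Set.finite_empty⟩
  | cons a w ih => exact IsFinite.sup ⟨Set.toFinite {_, _}, Set.toFinite {_, _}⟩ (ih _)

theorem IsFinite.smul {Δ : Subgr ι} (g : G) (h : Δ.IsFinite) : (g • Δ).IsFinite := by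
  refine ⟨h.1.preimage (mul_right_injective g⁻¹).injOn, h.2.preimage (Function.Injective.injOn ?_)⟩
  rintro ⟨a, x⟩ ⟨b, y⟩ hab
  simpa using hab

theorem HasPath.smul {Δ : Subgr ι} {a b : G} {w : Word X} (g : G) (hp : Δ.HasPath a w b) :
    (g • Δ).HasPath (g * a) w (g * b) := by
  induction w generalizing a with
  | nil =>
    obtain ⟨rfl, ha⟩ := hasPath_nil.mp hp
    exact hasPath_nil.mpr ⟨rfl, by simpa [mem_smul_verts] using ha⟩
  | cons x w ih =>
    obtain ⟨he, hp⟩ := hasPath_cons.mp hp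
    exact hasPath_cons.mpr ⟨by simpa [mem_smul_edges] using he, by simpa [mul_assoc] using ih hp⟩

theorem hasPath_smul_iff {Δ : Subgr ι} {g a b : G} {w : Word X} :
    (g • Δ).HasPath a w b ↔ Δ.HasPath (g⁻¹ * a) w (g⁻¹ * b) :=
  ⟨fun h => by simpa using h.smul g⁻¹, fun h => by simpa using h.smul g⟩

theorem IsConnected.smul {Δ : Subgr ι} (g : G) (h : Δ.IsConnected) : (g • Δ).IsConnected := by
  obtain ⟨⟨v, hv⟩, h⟩ := h
  refine ⟨⟨g * v, by simpa [mem_smul_verts] using hv⟩, fun a ha b hb => ?_⟩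
  obtain ⟨w, hw⟩ := h _ ha _ hb
  exact ⟨w, hasPath_smul_iff.mpr hw⟩

end Subgr

/-- `CSub Γ_X`: the poset of connected subgraphs of the Cayley graph of `G`. -/
abbrev CSub (ι : X → G) := {Δ : Subgr ι // Δ.IsConnected}

namespace CSub

variable {ι : X → G}

instance : MulAction G (CSub ι) where
  smul g Δ := ⟨g • Δ.1, Δ.2.smul g⟩
  one_smul Δ := Subtype.ext (one_smul G Δ.1)
  mul_smul g h Δ := Subtype.ext (mul_smul g h Δ.1)

theorem smul_le_iff {g : G} {Δ Ξ : CSub ι} : g • Δ ≤ Ξ ↔ Δ ≤ g⁻¹ • Ξ := Subgr.smul_le_iff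

theorem smul_mono {g : G} {Δ Ξ : CSub ι} (h : Δ ≤ Ξ) : g • Δ ≤ g • Ξ := Subgr.smul_mono h

/-- The union of two connected subgraphs with a common vertex. -/
def union (Δ Ξ : CSub ι) (h : (Δ.1.verts ∩ Ξ.1.verts).Nonempty) : CSub ι :=
  ⟨Δ.1 ⊔ Ξ.1, Δ.2.sup Ξ.2 h⟩

theorem union_le {Δ Ξ Ω : CSub ι} {h : (Δ.1.verts ∩ Ξ.1.verts).Nonempty} :
    union Δ Ξ h ≤ Ω ↔ Δ ≤ Ω ∧ Ξ ≤ Ω := sup_le_iff (a := Δ.1) (b := Ξ.1) (c := Ω.1)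

/-- The subgraph `⟨g w̄⟩` spanned by the path that starts at `g` and is labelled `w`. -/
def span (ι : X → G) (g : G) (w : Word X) : CSub ι := ⟨Subgr.span ι g w, Subgr.isConnected_span g w⟩

/-- The connected component of the subgraph `I` that contains the connected subgraph `Δ ≤ I`. -/
def component (I : Subgr ι) (Δ : CSub ι) (hΔ : Δ.1 ≤ I) : CSub ι :=
  ⟨{ verts := {h | ∃ g ∈ Δ.1.verts, ∃ w, I.HasPath g w h}
     edges := {e | e ∈ I.edges ∧ ∃ g ∈ Δ.1.verts, ∃ w, I.HasPath g w e.1}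
     src_mem := fun _ _ h => h.2
     tgt_mem := by
       rintro k a ⟨he, g, hg, w, hw⟩
       exact ⟨g, hg, _, hw.trans (Subgr.hasPath_cons.mpr
         ⟨he, Subgr.hasPath_nil.mpr ⟨rfl, I.tgt_mem _ _ he⟩⟩)⟩
     inv_mem := by
       rintro k a ⟨he, g, hg, w, hw⟩
       exact ⟨I.inv_mem _ _ he, g, hg, _, hw.trans (Subgr.hasPath_cons.mpr
         ⟨he, Subgr.hasPath_nil.mpr ⟨rfl, I.tgt_mem _ _ he⟩⟩)⟩ }, by
    have key : ∀ (D : Subgr ι), (∀ e, e ∈ D.edges ↔ e ∈ I.edges ∧ e.1 ∈ D.verts) →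
        ∀ w g k, g ∈ D.verts → I.HasPath g w k → D.HasPath g w k := by
      intro D hD w
      induction w with
      | nil =>
        intro g k hg hp
        exact Subgr.hasPath_nil.mpr ⟨(Subgr.hasPath_nil.mp hp).1, hg⟩
      | cons a w ih =>
        intro g k hg hp
        obtain ⟨he, hp⟩ := Subgr.hasPath_cons.mp hp
        have he' : (g, a) ∈ D.edges := (hD _).mpr ⟨he, hg⟩
        exact Subgr.hasPath_cons.mpr ⟨he', ih _ _ (D.tgt_mem _ _ he') hp⟩
    obtain ⟨g₀, hg₀⟩ := Δ.2.1
    have hb : ∃ g ∈ Δ.1.verts, ∃ w, I.HasPath g w g₀ :=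
      ⟨g₀, hg₀, [], Subgr.hasPath_nil.mpr ⟨rfl, hΔ.1 hg₀⟩⟩
    refine Subgr.isConnected_of_base g₀ hb ?_
    rintro k ⟨g, hg, w, hw⟩
    obtain ⟨u, hu⟩ := Δ.2.2 g₀ hg₀ g hg
    exact ⟨_, key _ (fun e => Iff.rfl) _ _ _ hb ((hu.mono hΔ).trans hw)⟩⟩

theorem component_le (I : Subgr ι) (Δ : CSub ι) (hΔ : Δ.1 ≤ I) : (component I Δ hΔ).1 ≤ I :=
  ⟨by rintro _ ⟨g, hg, w, hw⟩; exact hw.tgt, fun _ h => h.1⟩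

theorem le_component (I : Subgr ι) (Δ : CSub ι) (hΔ : Δ.1 ≤ I) : Δ ≤ component I Δ hΔ := by
  have hv : ∀ g ∈ Δ.1.verts, ∃ k ∈ Δ.1.verts, ∃ w, I.HasPath k w g := fun g hg =>
    ⟨g, hg, [], Subgr.hasPath_nil.mpr ⟨rfl, hΔ.1 hg⟩⟩
  exact ⟨hv, fun e he => ⟨hΔ.2 he, hv _ (Δ.1.src_mem _ _ he)⟩⟩

theorem component_hasPath {I : Subgr ι} {Δ : CSub ι} {hΔ : Δ.1 ≤ I} {g k : G} {w : Word X}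
    (hg : g ∈ (component I Δ hΔ).1.verts) (hp : I.HasPath g w k) :
    (component I Δ hΔ).1.HasPath g w k := by
  induction w generalizing g with
  | nil => exact Subgr.hasPath_nil.mpr ⟨(Subgr.hasPath_nil.mp hp).1, hg⟩
  | cons a w ih =>
    obtain ⟨he, hp⟩ := Subgr.hasPath_cons.mp hp
    have he' : (g, a) ∈ (component I Δ hΔ).1.edges := ⟨he, hg⟩
    exact Subgr.hasPath_cons.mpr ⟨he', ih (Subgr.tgt_mem _ _ _ he') hp⟩

end CSub

/-! ### Closure operators on `CSub Γ_X` -/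

section closure

variable {ι : X → G}

/-- `c` is `G`-invariant. -/
def IsInvariant (c : ClosureOperator (CSub ι)) : Prop :=
  ∀ (g : G) (Δ : CSub ι), c (g • Δ) = g • c Δ

/-- `c` is finitary: `Δ^c` is the union of the closures of the finite connected subgraphs of `Δ`. -/
def IsFinitary (c : ClosureOperator (CSub ι)) : Prop :=
  ∀ Δ : CSub ι,
    (c Δ).1.verts = ⋃ F ∈ {F : CSub ι | F ≤ Δ ∧ F.1.IsFinite}, (c F).1.verts ∧
    (c Δ).1.edges = ⋃ F ∈ {F : CSub ι | F ≤ Δ ∧ F.1.IsFinite}, (c F).1.edges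

/-- `Δ` is compact: it is the closure of a finite connected subgraph. -/
def IsCompactSub (c : ClosureOperator (CSub ι)) (Δ : CSub ι) : Prop :=
  ∃ F : CSub ι, F.1.IsFinite ∧ c F = Δ

/-- `Δ` is closed with respect to the relation `R` on words: for all `R`-related words `u`, `v`
and all vertices `g`, `h` of `Δ`, `u` labels a path in `Δ` from `g` to `h` iff `v` does. -/
def RelClosed (R : Word X → Word X → Prop) (Δ : CSub ι) : Prop :=
  ∀ u v, R u v → ∀ g ∈ Δ.1.verts, ∀ h ∈ Δ.1.verts, Δ.1.HasPath g u h ↔ Δ.1.HasPath g v h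

/-- The closure operator `c_R` on `CSub Γ_X` whose closed elements are the `R`-closed connected
subgraphs; here `R` is a relation such that `R`-related words are equal in `G`. -/
def relClosure (R : Word X → Word X → Prop)
    (hR : ∀ u v, R u v → wordVal ι u = wordVal ι v) : ClosureOperator (CSub ι) :=
  ClosureOperator.ofPred
    (fun Δ => CSub.component
      (Subgr.inter {D | ∃ Ξ : CSub ι, Δ ≤ Ξ ∧ RelClosed R Ξ ∧ Ξ.1 = D}) Δ
      (Subgr.le_inter.mpr (by rintro _ ⟨Ξ, h, -, rfl⟩; exact h)))
    (RelClosed R)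
    (fun Δ => CSub.le_component _ _ _)
    (fun Δ => by
      have key : ∀ u v, wordVal ι u = wordVal ι v →
          (∀ Ξ : CSub ι, RelClosed R Ξ → ∀ g ∈ Ξ.1.verts, ∀ h ∈ Ξ.1.verts,
            Ξ.1.HasPath g u h → Ξ.1.HasPath g v h) →
          ∀ (hI) (g h : G),
          (CSub.component (Subgr.inter {D | ∃ Ξ : CSub ι, Δ ≤ Ξ ∧ RelClosed R Ξ ∧ Ξ.1 = D})
            Δ hI).1.HasPath g u h →
          (CSub.component (Subgr.inter {D | ∃ Ξ : CSub ι, Δ ≤ Ξ ∧ RelClosed R Ξ ∧ Ξ.1 = D})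
            Δ hI).1.HasPath g v h := by
        intro u v huv H hI g h hp
        have hp' := hp.mono (CSub.component_le _ _ _)
        refine CSub.component_hasPath hp.src ⟨huv ▸ hp.1, Subgr.le_inter.mpr ?_⟩
        rintro _ ⟨Ξ, hΞ, hcl, rfl⟩
        have hq : Ξ.1.HasPath g u h := ⟨hp'.1, Subgr.le_inter.mp hp'.2 _ ⟨Ξ, hΞ, hcl, rfl⟩⟩
        exact (H Ξ hcl g hq.src h hq.tgt hq).2
      intro u v huv g hg h hh
      exact ⟨key u v (hR u v huv) (fun Ξ hΞ g hg h hh => (hΞ u v huv g hg h hh).1) _ g h,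
        key v u (hR u v huv).symm (fun Ξ hΞ g hg h hh => (hΞ u v huv g hg h hh).2) _ g h⟩)
    (fun Δ Ξ h hΞ => (CSub.component_le _ _ _).trans
      (Subgr.le_inter.mp le_rfl _ ⟨Ξ, h, hΞ, rfl⟩))

theorem RelClosed.smul {R : Word X → Word X → Prop} {Δ : CSub ι} (h : RelClosed R Δ) (g : G) :
    RelClosed R (g • Δ) := by
  intro u v huv a ha b hb
  exact Subgr.hasPath_smul_iff.trans ((h u v huv _ ha _ hb).trans Subgr.hasPath_smul_iff.symm)

theorem relClosure_invariant (R : Word X → Word X → Prop)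
    (hR : ∀ u v, R u v → wordVal ι u = wordVal ι v) : IsInvariant (relClosure R hR) := by
  have key : ∀ (g : G) (Δ : CSub ι), relClosure R hR (g • Δ) ≤ g • relClosure R hR Δ := by
    intro g Δ
    refine ClosureOperator.closure_min (CSub.smul_mono ((relClosure R hR).le_closure Δ)) ?_
    exact RelClosed.smul ((relClosure R hR).isClosed_closure Δ) g
  intro g Δ
  refine (key g Δ).antisymm ?_
  rw [CSub.smul_le_iff]
  simpa using key g⁻¹ (g • Δ)

end closure

/-! ### Schützenberger graphs and the closure operator of an `E`-unitary inverse monoid -/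

/-- `S` is an `E`-unitary inverse monoid, `X`-generated via `ιS`, with greatest group image `G`
via `φ : S → G`, where `G` is viewed as an `X`-generated group via `ι = φ ∘ ιS`. -/
structure IsXGenEUnitary {S : Type*} [InverseMonoid S] (ιS : X → S) (ι : X → G) (φ : S →* G) :
    Prop where
  generates : Generates ιS
  eUnitary : IsEUnitary S
  image : IsGreatestGroupImage φ
  canonical : ∀ x, φ (ιS x) = ι x

section monoid

variable {S : Type*} [InverseMonoid S] {ιS : X → S} {ι : X → G} {φ : S →* G}

/-- The vertex set of the Schützenberger graph `SΓ(s)`: the strong component of `s` in the Cayley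
graph of `S`. (The path labelled `w` starting at `s` in the Cayley graph of `S` ends at
`s * w_S`.) -/
def strongComponent (ιS : X → S) (s : S) : Set S :=
  {t | (∃ u, s * wordVal ιS u = t) ∧ ∃ v, t * wordVal ιS v = s}

theorem strongComponent_return {s t : S} {a : Letter X} (ht : t ∈ strongComponent ιS s)
    (hta : t * letterVal ιS a ∈ strongComponent ιS s) :
    t * letterVal ιS a * letterVal ιS a.flip = t := by
  obtain ⟨⟨u, hu⟩, -⟩ := ht
  obtain ⟨-, v, hv⟩ := hta
  rw [letterVal_flip']
  refine mul_mul_inv_of_return (y := wordVal ιS (v ++ u)) ?_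
  rw [wordVal_append, ← mul_assoc, hv, hu]

/-- The Schützenberger graph `SΓ(s)`, viewed as a subgraph of the Cayley graph of `G` by means of
the graph morphism induced by `φ`: the edges of `SΓ(s)` are the edges of the Cayley graph of `S`
with both end points in the strong component of `s`. -/
def schutzenbergerSubgr (h : IsXGenEUnitary ιS ι φ) (s : S) : Subgr ι where
  verts := φ '' strongComponent ιS s
  edges := {e | ∃ t ∈ strongComponent ιS s,
    t * letterVal ιS e.2 ∈ strongComponent ιS s ∧ φ t = e.1}
  src_mem := by rintro _ a ⟨t, ht, -, rfl⟩; exact ⟨t, ht, rfl⟩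
  tgt_mem := by
    rintro _ a ⟨t, -, ht, rfl⟩
    exact ⟨_, ht, by rw [map_mul, map_letterVal h.canonical]⟩
  inv_mem := by
    rintro _ a ⟨t, ht, hta, rfl⟩
    refine ⟨_, hta, ?_, by rw [map_mul, map_letterVal h.canonical]⟩
    simpa only [strongComponent_return ht hta] using ht

theorem schutzenbergerSubgr_isConnected (h : IsXGenEUnitary ιS ι φ) (s : S) :
    (schutzenbergerSubgr h s).IsConnected := by
  have hs : s ∈ strongComponent ιS s := ⟨⟨[], by simp⟩, [], by simp⟩
  refine Subgr.isConnected_of_base (φ s) ⟨s, hs, rfl⟩ ?_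
  rintro _ ⟨t, ⟨⟨u, hu⟩, v, hv⟩, rfl⟩
  refine ⟨u, ?_⟩
  have key : ∀ (w : Word X) (r : S), r ∈ strongComponent ιS s → r * wordVal ιS w = t →
      (schutzenbergerSubgr h s).HasPath (φ r) w (φ t) := by
    intro w
    induction w with
    | nil =>
      rintro r hr hrt
      exact Subgr.hasPath_nil.mpr ⟨by rw [← hrt]; simp, r, hr, rfl⟩
    | cons a w ih =>
      rintro r hr hrt
      rw [wordVal_cons, ← mul_assoc] at hrt
      have hra : r * letterVal ιS a ∈ strongComponent ιS s := by
        obtain ⟨⟨p, hp⟩, -⟩ := hr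
        refine ⟨⟨p ++ [a], ?_⟩, w ++ v, ?_⟩
        · rw [wordVal_append, ← mul_assoc, hp]; simp
        · rw [wordVal_append, ← mul_assoc, hrt, hv]
      refine Subgr.hasPath_cons.mpr ⟨⟨r, hr, hra, rfl⟩, ?_⟩
      have := ih _ hra hrt
      rwa [map_mul, map_letterVal h.canonical] at this
  exact key u s hs hu

/-- `SΓ(s)` as an element of `CSub Γ_X`. -/
def schutzenberger (h : IsXGenEUnitary ιS ι φ) (s : S) : CSub ι :=
  ⟨schutzenbergerSubgr h s, schutzenbergerSubgr_isConnected h s⟩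

/-- The closure operator `c_S` on `CSub Γ_X` of an `X`-generated `E`-unitary inverse monoid `S`
with greatest group image `G`: it is `c_R` for the relation `R` of representing the same element
of `S`. -/
def closureOf (h : IsXGenEUnitary ιS ι φ) : ClosureOperator (CSub ι) :=
  relClosure (fun u v => wordVal ιS u = wordVal ιS v) (fun u v huv => by
    rw [← map_wordVal h.canonical, huv, map_wordVal h.canonical])

theorem closureOf_invariant (h : IsXGenEUnitary ιS ι φ) : IsInvariant (closureOf h) :=
  relClosure_invariant _ _

end monoid

/-! ### The inverse monoid of a closure operator -/

/-- The elements of `S_c`: pairs `(Δ, g)` with `Δ` a compact connected subgraph containing `1`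
and `g`. -/
@[ext]
structure MonoidOf {ι : X → G} (c : ClosureOperator (CSub ι)) (hc : IsInvariant c) where
  graph : CSub ι
  elt : G
  compact : IsCompactSub c graph
  one_mem : (1 : G) ∈ graph.1.verts
  elt_mem : elt ∈ graph.1.verts

namespace MonoidOf

variable {ι : X → G} {c : ClosureOperator (CSub ι)} {hc : IsInvariant c}

theorem isClosed_smul (hc : IsInvariant c) {Δ : CSub ι} (h : c.IsClosed Δ) (g : G) :
    c.IsClosed (g • Δ) := by
  rw [c.isClosed_iff] at h ⊢
  exact (hc g Δ).trans (congrArg (g • ·) h)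

theorem _root_.XGraph.IsCompactSub.isClosed {Δ : CSub ι} (h : IsCompactSub c Δ) :
    c.IsClosed Δ := by
  obtain ⟨F, -, rfl⟩ := h
  exact c.isClosed_closure F

theorem _root_.XGraph.IsCompactSub.smul (hc : IsInvariant c) {Δ : CSub ι}
    (h : IsCompactSub c Δ) (g : G) : IsCompactSub c (g • Δ) := by
  obtain ⟨F, hF, rfl⟩ := h
  exact ⟨g • F, hF.smul g, hc g F⟩

/-- A compact graph is the closure of a finite connected graph through any given vertex. -/
theorem _root_.XGraph.IsCompactSub.exists_mem {Δ : CSub ι} (h : IsCompactSub c Δ) {g : G}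
    (hg : g ∈ Δ.1.verts) : ∃ F : CSub ι, F.1.IsFinite ∧ c F = Δ ∧ g ∈ F.1.verts := by
  obtain ⟨F, hF, rfl⟩ := h
  obtain ⟨k, hk⟩ := F.2.1
  obtain ⟨w, hw⟩ := (c F).2.2 g hg k ((c.le_closure F).1 hk)
  have hk' : k ∈ (Subgr.span ι g w).verts := by
    have : (Subgr.span ι g w).HasPath g w k := ⟨hw.1, le_rfl⟩
    exact this.tgt
  refine ⟨CSub.union F (CSub.span ι g w) ⟨k, hk, hk'⟩, hF.sup (Subgr.isFinite_span g w), ?_,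
    Or.inr (Subgr.src_mem_span g w)⟩
  refine le_antisymm ?_ (c.monotone (le_sup_left (a := F.1) (b := Subgr.span ι g w)))
  exact ClosureOperator.closure_min (CSub.union_le.mpr ⟨c.le_closure F, hw.2⟩)
    (c.isClosed_closure F)

theorem _root_.XGraph.IsCompactSub.union {Δ Ξ : CSub ι} (hΔ : IsCompactSub c Δ)
    (hΞ : IsCompactSub c Ξ) (h : (Δ.1.verts ∩ Ξ.1.verts).Nonempty) :
    IsCompactSub c (c (CSub.union Δ Ξ h)) := by
  obtain ⟨g, hg, hg'⟩ := h
  obtain ⟨F, hF, rfl, hgF⟩ := hΔ.exists_mem hg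
  obtain ⟨H, hH, rfl, hgH⟩ := hΞ.exists_mem hg'
  refine ⟨CSub.union F H ⟨g, hgF, hgH⟩, hF.sup hH, le_antisymm ?_ ?_⟩
  · exact c.monotone (sup_le_sup (a := F.1) (b := (c F).1) (c := H.1) (d := (c H).1)
      (c.le_closure F) (c.le_closure H))
  · refine ClosureOperator.closure_min (CSub.union_le.mpr ⟨?_, ?_⟩) (c.isClosed_closure _)
    · exact c.monotone (le_sup_left (a := F.1) (b := H.1))
    · exact c.monotone (le_sup_right (a := F.1) (b := H.1))

theorem inter_nonempty (a b : MonoidOf c hc) :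
    (a.graph.1.verts ∩ (a.elt • b.graph).1.verts).Nonempty :=
  ⟨a.elt, a.elt_mem, by
    change a.elt⁻¹ * a.elt ∈ b.graph.1.verts
    rw [inv_mul_cancel]; exact b.one_mem⟩

/-- `(Δ, g)(Ξ, h) = ((Δ ∪ gΞ)^c, gh)`. -/
instance : Mul (MonoidOf c hc) where
  mul a b :=
    { graph := c (CSub.union a.graph (a.elt • b.graph) (inter_nonempty a b))
      elt := a.elt * b.elt
      compact := a.compact.union (b.compact.smul hc a.elt) _
      one_mem := (c.le_closure _).1 (Or.inl a.one_mem)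
      elt_mem := (c.le_closure _).1 (Or.inr (by
        change a.elt⁻¹ * (a.elt * b.elt) ∈ b.graph.1.verts
        rw [inv_mul_cancel_left]; exact b.elt_mem)) }

/-- The identity element is `({1}^c, 1)`. -/
instance : One (MonoidOf c hc) where
  one :=
    { graph := c (CSub.span ι 1 [])
      elt := 1
      compact := ⟨_, Subgr.isFinite_span 1 [], rfl⟩
      one_mem := (c.le_closure _).1 (Subgr.src_mem_span 1 [])
      elt_mem := (c.le_closure _).1 (Subgr.src_mem_span 1 []) }

/-- `(Δ, g)⁻¹ = (g⁻¹Δ, g⁻¹)`. -/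
instance : Inv (MonoidOf c hc) where
  inv a :=
    { graph := a.elt⁻¹ • a.graph
      elt := a.elt⁻¹
      compact := a.compact.smul hc _
      one_mem := by
        change a.elt⁻¹⁻¹ * 1 ∈ a.graph.1.verts
        simpa using a.elt_mem
      elt_mem := by
        change a.elt⁻¹⁻¹ * a.elt⁻¹ ∈ a.graph.1.verts
        simpa using a.one_mem }

@[simp] theorem elt_mul (a b : MonoidOf c hc) : (a * b).elt = a.elt * b.elt := rfl
@[simp] theorem elt_one : (1 : MonoidOf c hc).elt = 1 := rfl
@[simp] theorem elt_inv (a : MonoidOf c hc) : (a⁻¹).elt = a.elt⁻¹ := rfl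
@[simp] theorem graph_inv (a : MonoidOf c hc) : (a⁻¹).graph = a.elt⁻¹ • a.graph := rfl

theorem graph_mul_le {a b : MonoidOf c hc} {Δ : CSub ι} (hΔ : c.IsClosed Δ) :
    (a * b).graph ≤ Δ ↔ a.graph ≤ Δ ∧ b.graph ≤ a.elt⁻¹ • Δ := by
  refine (ClosureOperator.IsClosed.closure_le_iff hΔ).trans ?_
  rw [CSub.union_le, CSub.smul_le_iff]

theorem graph_one_le {Δ : CSub ι} (hΔ : c.IsClosed Δ) :
    (1 : MonoidOf c hc).graph ≤ Δ ↔ (1 : G) ∈ Δ.1.verts :=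
  (ClosureOperator.IsClosed.closure_le_iff hΔ).trans Subgr.single_le

theorem ext_of {a b : MonoidOf c hc} (he : a.elt = b.elt)
    (hg : ∀ Δ, c.IsClosed Δ → (a.graph ≤ Δ ↔ b.graph ≤ Δ)) : a = b :=
  MonoidOf.ext (le_antisymm ((hg _ b.compact.isClosed).2 le_rfl)
    ((hg _ a.compact.isClosed).1 le_rfl)) he

/-- The inverse monoid `S_c`. -/
instance : InverseMonoid (MonoidOf c hc) where
  mul_assoc x y z := by
    refine ext_of (by simp [mul_assoc]) fun Δ hΔ => ?_
    rw [graph_mul_le hΔ, graph_mul_le hΔ, graph_mul_le hΔ, graph_mul_le (isClosed_smul hc hΔ _),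
      elt_mul, mul_inv_rev, mul_smul, and_assoc]
  one_mul x := by
    refine ext_of (by simp) fun Δ hΔ => ?_
    rw [graph_mul_le hΔ, graph_one_le hΔ, elt_one, inv_one, one_smul]
    exact ⟨fun h => h.2, fun h => ⟨h.1 x.one_mem, h⟩⟩
  mul_one x := by
    refine ext_of (by simp) fun Δ hΔ => ?_
    rw [graph_mul_le hΔ, graph_one_le (isClosed_smul hc hΔ _)]
    refine ⟨fun h => h.1, fun h => ⟨h, ?_⟩⟩
    change x.elt⁻¹⁻¹ * 1 ∈ Δ.1.verts
    simpa using h.1 x.elt_mem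
  mul_inv_mul x := by
    refine ext_of (by simp) fun Δ hΔ => ?_
    rw [graph_mul_le hΔ, graph_mul_le hΔ]
    simp [CSub.smul_le_iff]
  inv_mul_inv x := by
    refine ext_of (by simp) fun Δ hΔ => ?_
    rw [graph_mul_le hΔ, graph_mul_le hΔ]
    simp [CSub.smul_le_iff]
  inv_unique x y hx hy := by
    have he : y.elt = x.elt⁻¹ := by
      have := congrArg MonoidOf.elt hx
      simp only [elt_mul, mul_eq_right] at this
      exact eq_inv_of_mul_eq_one_right this
    have h1 := ((graph_mul_le x.compact.isClosed).1 (le_of_eq (congrArg graph hx))).1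
    have h2 := ((graph_mul_le y.compact.isClosed).1 (le_of_eq (congrArg graph hy))).1
    rw [graph_mul_le x.compact.isClosed] at h1
    rw [graph_mul_le y.compact.isClosed, he, inv_inv] at h2
    refine MonoidOf.ext (le_antisymm h1.2 ?_) he
    rw [graph_inv, CSub.smul_le_iff, inv_inv]
    exact h2.2

/-- The map `X → S_c`, `x ↦ (⟨x̄⟩^c, x_G)`. -/
def gen (c : ClosureOperator (CSub ι)) (hc : IsInvariant c) (x : X) : MonoidOf c hc where
  graph := c (CSub.span ι 1 [(x, true)])
  elt := ι x
  compact := ⟨_, Subgr.isFinite_span 1 _, rfl⟩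
  one_mem := (c.le_closure _).1 (Subgr.src_mem_span 1 _)
  elt_mem := (c.le_closure _).1 (Or.inr (by simp [Subgr.span, Subgr.single, letterVal]))

/-- The projection `S_c → G`, `(Δ, g) ↦ g`. -/
def proj (c : ClosureOperator (CSub ι)) (hc : IsInvariant c) : MonoidOf c hc →* G where
  toFun := MonoidOf.elt
  map_one' := rfl
  map_mul' _ _ := rfl

end MonoidOf

end XGraph

/-! A word `w` has a value in the monoid and also traces a path from `1` in the Cayley graph of `G`;
both claims compare the two. For an `E`-unitary `S`, the projection to `G` is injective on each
strong component, that is, on each `ℛ`-class (`eq_of_mul_inv_eq`). Paths in the image of `SΓ(s)`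
therefore lift to the Cayley graph of `S`, and the `c_S`-closure of the path of `w` is exactly
`SΓ(w_S)` (`closureOf_span`). In any `S_c` the value of `w` is the closure of its path paired with
`w_G` (`graph_wordVal`, `elt_wordVal`). Hence `ψ` sends `w_S` to the value of `w` in `S_{c_S}`. It
is multiplicative by concatenation of words, onto because `S_c` is generated by `X`, and injective
because the graph and the `σ`-class together determine `s` (`eq_of_schutzenberger_eq`).

Generation of `S_c` holds because a finite connected graph is spanned by a single walk
(`exists_span_eq`). For `c = c_{S_c}` the closed subgraphs are compared. A `c`-closed graph contains
a path from `g` iff it contains the `g`-translate of the path's graph component, which depends only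
on the value of the word. Conversely, let `Δ` be closed for equality in `S_c` and let `F ⊆ Δ` be
finite, spanned by a closed walk `w`. Each path `p` of `F^c` from the same base point has `ww⁻¹ ≤
pp⁻¹` in `S_c`, so `p` lies in `Δ` (`hasPath_of_wordVal`). Thus `F^c ⊆ Δ`, and finitarity gives `Δ^c
= Δ`. -/

namespace InverseMonoid

variable {S : Type*} [InverseMonoid S]

/-! ### Algebra of inverse monoids -/

theorem mul_inv_rev' (a b : S) : (a * b)⁻¹ = b⁻¹ * a⁻¹ := by
  have hc := idem_comm (idem_inv_mul a) (idem_mul_inv b)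
  refine (inv_unique _ _ ?_ ?_).symm
  · calc a * b * (b⁻¹ * a⁻¹) * (a * b) = a * (b * b⁻¹ * (a⁻¹ * a)) * b := by simp only [mul_assoc]
      _ = a * a⁻¹ * a * (b * b⁻¹ * b) := by rw [← hc]; simp only [mul_assoc]
      _ = a * b := by rw [mul_inv_mul, mul_inv_mul]
  · calc b⁻¹ * a⁻¹ * (a * b) * (b⁻¹ * a⁻¹) = b⁻¹ * (a⁻¹ * a * (b * b⁻¹)) * a⁻¹ := by
          simp only [mul_assoc]
      _ = b⁻¹ * b * b⁻¹ * (a⁻¹ * a * a⁻¹) := by rw [hc]; simp only [mul_assoc]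
      _ = b⁻¹ * a⁻¹ := by rw [inv_mul_inv, inv_mul_inv]

theorem inv_eq_of_isIdempotentElem {e : S} (he : IsIdempotentElem e) : e⁻¹ = e :=
  (inv_unique e e (by rw [he.eq, he.eq]) (by rw [he.eq, he.eq])).symm

theorem map_inv_of_monoidHom {T : Type*} [InverseMonoid T] {F : Type*} [FunLike F S T]
    [MonoidHomClass F S T] (f : F) (a : S) : f a⁻¹ = (f a)⁻¹ :=
  inv_unique _ _ (by rw [← map_mul, ← map_mul, mul_inv_mul])
    (by rw [← map_mul, ← map_mul, inv_mul_inv])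

theorem one_inv : (1 : S)⁻¹ = 1 := inv_eq_of_isIdempotentElem (mul_one 1)

/-- In an `E`-unitary inverse monoid, `σ` meets the relation `ℛ` trivially. -/
theorem eq_of_mul_inv_eq {G : Type*} [Group G] {φ : S →* G} (hE : IsEUnitary S)
    (hφ : IsGreatestGroupImage φ) {s t : S} (h : s * s⁻¹ = t * t⁻¹) (hst : φ s = φ t) : s = t := by
  -- `s⁻¹t` is `σ`-related to `1`, so `E`-unitarity makes it idempotent, hence equal to its own
  -- inverse `t⁻¹s`. Right multiplication by it then swaps `s` and `t`, and idempotency forces them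
  -- to coincide.
  have hf : IsIdempotentElem (s⁻¹ * t) := by
    rw [← hE, ← hφ.2, map_mul, map_inv', hst, inv_mul_cancel, map_one]
  have hf' : t⁻¹ * s = s⁻¹ * t := by
    rw [← inv_eq_of_isIdempotentElem hf, mul_inv_rev', inv_inv']
  have h1 : s * (s⁻¹ * t) = t := by rw [← mul_assoc, h, mul_inv_mul]
  have h2 : t * (s⁻¹ * t) = s := by rw [← hf', ← mul_assoc, ← h, mul_inv_mul]
  calc s = s * (s⁻¹ * t) * (s⁻¹ * t) := by rw [h1, h2]
    _ = t := by rw [mul_assoc, hf.eq, h1]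

end InverseMonoid

/-! ### Words, paths and spanning walks -/

namespace XGraph

open InverseMonoid

variable {X G : Type*} [Group G]

/-- The formal inverse of a word. -/
def Word.inv (w : Word X) : Word X := (w.map Letter.flip).reverse

theorem Word.inv_cons (a : Letter X) (w : Word X) : Word.inv (a :: w) = Word.inv w ++ [a.flip] := by
  simp [Word.inv]

theorem wordVal_inv {S : Type*} [InverseMonoid S] (ιS : X → S) (w : Word X) :
    wordVal ιS (Word.inv w) = (wordVal ιS w)⁻¹ := by
  induction w with
  | nil => simp [Word.inv, one_inv]
  | cons a w ih => simp [Word.inv_cons, ih, letterVal_flip', mul_inv_rev']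

theorem exists_wordVal {S : Type*} [InverseMonoid S] {ιS : X → S} (h : Generates ιS) (s : S) :
    ∃ w, wordVal ιS w = s := by
  refine h
    { carrier := {s | ∃ w, wordVal ιS w = s}
      one_mem' := ⟨[], rfl⟩
      mul_mem' := ?_ } (fun x => ⟨[(x, true)], by simp [letterVal]⟩) ?_ s
  · rintro _ _ ⟨u, rfl⟩ ⟨v, rfl⟩
    exact ⟨u ++ v, wordVal_append _ _ _⟩
  · rintro _ ⟨u, rfl⟩
    exact ⟨_, wordVal_inv _ _⟩

namespace Subgr

variable {ι : X → G}

theorem hasPath_append {Δ : Subgr ι} {g h : G} {u v : Word X} :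
    Δ.HasPath g (u ++ v) h ↔ ∃ k, Δ.HasPath g u k ∧ Δ.HasPath k v h := by
  refine ⟨fun hp => ?_, fun ⟨k, hu, hv⟩ => hu.trans hv⟩
  induction u generalizing g with
  | nil => exact ⟨g, hasPath_nil.mpr ⟨rfl, hp.src⟩, hp⟩
  | cons a u ih =>
    obtain ⟨he, hp⟩ := hasPath_cons.mp hp
    obtain ⟨k, hu, hv⟩ := ih hp
    exact ⟨k, hasPath_cons.mpr ⟨he, hu⟩, hv⟩

theorem HasPath.inv {Δ : Subgr ι} {g h : G} {w : Word X} (hp : Δ.HasPath g w h) :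
    Δ.HasPath h (Word.inv w) g := by
  induction w generalizing g with
  | nil =>
    obtain ⟨rfl, hg⟩ := hasPath_nil.mp hp
    exact hasPath_nil.mpr ⟨rfl, hg⟩
  | cons a w ih =>
    obtain ⟨he, hp⟩ := hasPath_cons.mp hp
    rw [Word.inv_cons]
    refine (ih hp).trans (hasPath_cons.mpr ⟨Δ.inv_mem _ _ he, ?_⟩)
    simpa [hasPath_nil] using Δ.src_mem _ _ he

/-- The span of a path is the least subgraph containing that path, so each inclusion follows by
translating the path. -/
theorem smul_span (g k : G) (w : Word X) : g • span ι k w = span ι (g * k) w := by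
  apply le_antisymm
  · rw [smul_le_iff]
    have : (span ι (g * k) w).HasPath (g * k) w (g * k * wordVal ι w) := ⟨rfl, le_rfl⟩
    simpa using (this.smul g⁻¹).2
  · have : (span ι k w).HasPath k w (k * wordVal ι w) := ⟨rfl, le_rfl⟩
    exact (this.smul g).2

theorem span_append (g : G) (u v : Word X) :
    span ι g (u ++ v) = span ι g u ⊔ span ι (g * wordVal ι u) v := by
  apply le_antisymm
  · have h1 : (span ι g u ⊔ span ι (g * wordVal ι u) v).HasPath g u (g * wordVal ι u) :=
      ⟨rfl, le_sup_left⟩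
    exact (h1.trans (w := v) ⟨rfl, le_sup_right⟩).2
  · obtain ⟨k, ⟨rfl, hu⟩, hv⟩ := hasPath_append.mp
      (⟨rfl, le_rfl⟩ : (span ι g (u ++ v)).HasPath g (u ++ v) _)
    exact sup_le hu hv.2

/-- A connected subgraph is determined by the paths starting at one of its vertices. -/
theorem IsConnected.le_of_hasPath {Δ Ξ : Subgr ι} (hΔ : Δ.IsConnected) {g : G} (hg : g ∈ Δ.verts)
    (h : ∀ w k, Δ.HasPath g w k → Ξ.HasPath g w k) : Δ ≤ Ξ := by
  refine ⟨fun k hk => ?_, fun e he => ?_⟩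
  · obtain ⟨w, hw⟩ := hΔ.2 g hg k hk
    exact (h w k hw).tgt
  · obtain ⟨k, a⟩ := e
    obtain ⟨w, hw⟩ := hΔ.2 g hg k (Δ.src_mem _ _ he)
    -- An edge is detected by a path that ends by crossing it; the label and starting point of a
    -- path fix its vertices, so the transferred path crosses the same edge.
    have hp : Δ.HasPath g (w ++ [a]) (k * letterVal ι a) :=
      hw.trans (hasPath_cons.mpr ⟨he, hasPath_nil.mpr ⟨rfl, Δ.tgt_mem _ _ he⟩⟩)
    obtain ⟨k', h1, h2⟩ := hasPath_append.mp (h _ _ hp)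
    obtain rfl : k = k' := hw.1.symm.trans h1.1
    exact (hasPath_cons.mp h2).1

/-- A finite connected subgraph is spanned by a path with prescribed end points. -/
theorem IsConnected.exists_span_eq {Δ : Subgr ι} (hΔ : Δ.IsConnected) (hfin : Δ.IsFinite) {g k : G}
    (hg : g ∈ Δ.verts) (hk : k ∈ Δ.verts) : ∃ w, Δ.HasPath g w k ∧ span ι g w = Δ := by
  -- The edges of `E` are collected one at a time: from the current end point, walk inside `Δ` to
  -- the source of the new edge and cross it.
  have key : ∀ E : Set (G × Letter X), E.Finite → E ⊆ Δ.edges →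
      ∃ w h, Δ.HasPath g w h ∧ E ⊆ (span ι g w).edges := by
    intro E hE
    induction E, hE using Set.Finite.induction_on with
    | empty => exact fun _ => ⟨[], g, hasPath_nil.mpr ⟨rfl, hg⟩, Set.empty_subset _⟩
    | @insert e E _ _ ih =>
      intro hsub
      obtain ⟨a, x⟩ := e
      have he : (a, x) ∈ Δ.edges := hsub (Set.mem_insert _ _)
      obtain ⟨w, h, hw, hE⟩ := ih ((Set.subset_insert _ _).trans hsub)
      obtain ⟨u, hu⟩ := hΔ.2 h hw.tgt a (Δ.src_mem _ _ he)
      refine ⟨w ++ (u ++ [x]), _, hw.trans (hu.trans (hasPath_cons.mpr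
        ⟨he, hasPath_nil.mpr ⟨rfl, Δ.tgt_mem _ _ he⟩⟩)), ?_⟩
      have hlast : (a, x) ∈ (span ι h (u ++ [x])).edges := by
        rw [span_append, hu.1]
        exact Or.inr (Or.inl (Or.inl rfl))
      rw [span_append, hw.1]
      exact Set.insert_subset (Or.inr hlast) (hE.trans Set.subset_union_left)
  obtain ⟨w, h, hw, hE⟩ := key _ hfin.2 subset_rfl
  obtain ⟨u, hu⟩ := hΔ.2 h hw.tgt k hk
  have hp := hw.trans hu
  refine ⟨w ++ u, hp, le_antisymm hp.2 ?_⟩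
  have hE' : Δ.edges ⊆ (span ι g (w ++ u)).edges := by
    rw [span_append]
    exact hE.trans Set.subset_union_left
  refine hΔ.le_of_hasPath hg fun v m hv => ?_
  -- Once the walk covers all edges of `Δ`, any path of `Δ` starting on the walk stays in its span;
  -- connectedness then accounts for the vertices too.
  have : ∀ (v : Word X) (b : G), b ∈ (span ι g (w ++ u)).verts → Δ.HasPath b v m →
      (span ι g (w ++ u)).HasPath b v m := by
    intro v
    induction v with
    | nil => exact fun b hb hp => hasPath_nil.mpr ⟨(hasPath_nil.mp hp).1, hb⟩
    | cons x v ih =>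
      intro b hb hp
      obtain ⟨he, hp⟩ := hasPath_cons.mp hp
      exact hasPath_cons.mpr ⟨hE' he, ih _ (tgt_mem _ _ _ (hE' he)) hp⟩
  exact this v g (src_mem_span _ _) hv

end Subgr

theorem CSub.smul_span {ι : X → G} (g k : G) (w : Word X) :
    g • CSub.span ι k w = CSub.span ι (g * k) w :=
  Subtype.ext (Subgr.smul_span g k w)

/-- Closedness with respect to equality in `S` transfers paths along the natural order. -/
theorem RelClosed.hasPath_of_wordVal {S : Type*} [InverseMonoid S] {ιS : X → S} {ι : X → G}
    {Δ : CSub ι} (hΔ : RelClosed (fun u v => wordVal ιS u = wordVal ιS v) Δ) {w p : Word X}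
    {g k m : G} (hw : Δ.1.HasPath g w k) (hp : g * wordVal ι p = m)
    (h : wordVal ιS w * (wordVal ιS w)⁻¹ * (wordVal ιS p * (wordVal ιS p)⁻¹) =
      wordVal ιS w * (wordVal ιS w)⁻¹) : Δ.1.HasPath g p m := by
  -- The hypothesis says `ww⁻¹ ≤ pp⁻¹`, so `ww⁻¹` and `ww⁻¹pp⁻¹` have the same value. The first
  -- labels a loop at `g` in `Δ`, hence so does the second, and `p` is read from `g` along it.
  have hloop := (hΔ (w ++ Word.inv w) (w ++ Word.inv w ++ (p ++ Word.inv p))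
    (by simp only [wordVal_append, wordVal_inv, h]) g hw.src g hw.src).1 (hw.trans hw.inv)
  obtain ⟨a, h1, h2⟩ := Subgr.hasPath_append.mp hloop
  obtain ⟨b, h3, -⟩ := Subgr.hasPath_append.mp h2
  obtain rfl : a = g := h1.1.symm.trans (hw.trans hw.inv).1
  obtain rfl : b = m := h3.1.symm.trans hp
  exact h3

/-! ### Schützenberger graphs of an `E`-unitary inverse monoid -/

section monoid

variable {S : Type*} [InverseMonoid S] {ιS : X → S} {ι : X → G} {φ : S →* G}

/-- Strong components are `ℛ`-classes: a return path preserves `ss⁻¹`, and `ℛ`-related elements are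
joined by words for `s⁻¹t` and `t⁻¹s`. -/
theorem mem_strongComponent_iff (h : Generates ιS) {s t : S} :
    t ∈ strongComponent ιS s ↔ t * t⁻¹ = s * s⁻¹ := by
  constructor
  · rintro ⟨⟨u, rfl⟩, v, hv⟩
    rw [mul_inv_rev', ← mul_assoc, mul_mul_inv_of_return hv]
  · intro hts
    obtain ⟨u, hu⟩ := exists_wordVal h (s⁻¹ * t)
    obtain ⟨v, hv⟩ := exists_wordVal h (t⁻¹ * s)
    exact ⟨⟨u, by rw [hu, ← mul_assoc, ← hts, mul_inv_mul]⟩,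
      v, by rw [hv, ← mul_assoc, hts, mul_inv_mul]⟩

/-- Path lifting: an edge of the image leaving `φ t` comes from an edge leaving some `r` over the
same vertex, and `r = t` by `E`-unitarity. In the other direction, a path of `S` that ends in the
strong component never left it. -/
theorem schutzenbergerSubgr_hasPath_iff (h : IsXGenEUnitary ιS ι φ) {s t : S}
    (ht : t ∈ strongComponent ιS s) {w : Word X} {k : G} :
    (schutzenbergerSubgr h s).HasPath (φ t) w k ↔
      φ t * wordVal ι w = k ∧ t * wordVal ιS w ∈ strongComponent ιS s := by
  induction w generalizing t with
  | nil =>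
    rw [Subgr.hasPath_nil]
    have hv : φ t ∈ (schutzenbergerSubgr h s).verts := ⟨t, ht, rfl⟩
    simp [ht, hv]
  | cons a w ih =>
    rw [Subgr.hasPath_cons, wordVal_cons, wordVal_cons, ← mul_assoc, ← mul_assoc,
      ← map_letterVal h.canonical, ← map_mul]
    constructor
    · rintro ⟨⟨r, hr, hra, hrt⟩, hp⟩
      obtain rfl : r = t := eq_of_mul_inv_eq h.eUnitary h.image
        (((mem_strongComponent_iff h.generates).1 hr).trans
          ((mem_strongComponent_iff h.generates).1 ht).symm) hrt
      exact (ih hra).1 hp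
    · rintro ⟨hk, hw⟩
      have hta : t * letterVal ιS a ∈ strongComponent ιS s := by
        obtain ⟨⟨p, hp⟩, -⟩ := ht
        obtain ⟨-, v, hv⟩ := hw
        exact ⟨⟨p ++ [a], by rw [wordVal_append, ← mul_assoc, hp]; simp⟩,
          w ++ v, by rw [wordVal_append, ← mul_assoc, hv]⟩
      exact ⟨⟨t, ht, hta, rfl⟩, (ih hta).2 ⟨hk, hw⟩⟩

theorem schutzenberger_relClosed (h : IsXGenEUnitary ιS ι φ) (s : S) :
    RelClosed (fun u v => wordVal ιS u = wordVal ιS v) (schutzenberger h s) := by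
  rintro u v huv _ ⟨t, ht, rfl⟩ k -
  refine (schutzenbergerSubgr_hasPath_iff h ht).trans
    (Iff.trans ?_ (schutzenbergerSubgr_hasPath_iff h ht).symm)
  rw [← map_wordVal h.canonical, ← map_wordVal h.canonical, huv]

/-- The idempotent `ss⁻¹` lies over `1`, so paths in `SΓ(s)` can be based at `1`. -/
theorem mul_inv_mem_strongComponent (h : Generates ιS) (s : S) :
    s * s⁻¹ ∈ strongComponent ιS s := by
  rw [mem_strongComponent_iff h, mul_inv_rev', inv_inv', idem_mul_inv]

theorem schutzenbergerSubgr_one_hasPath_iff (h : IsXGenEUnitary ιS ι φ) {s : S} {w : Word X}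
    {k : G} : (schutzenbergerSubgr h s).HasPath 1 w k ↔
      wordVal ι w = k ∧ s * s⁻¹ * wordVal ιS w ∈ strongComponent ιS s := by
  have := schutzenbergerSubgr_hasPath_iff h (mul_inv_mem_strongComponent h.generates s)
    (w := w) (k := k)
  simpa [map_inv'] using this

theorem schutzenbergerSubgr_hasPath_self (h : IsXGenEUnitary ιS ι φ) (w : Word X) :
    (schutzenbergerSubgr h (wordVal ιS w)).HasPath 1 w (wordVal ι w) := by
  rw [schutzenbergerSubgr_one_hasPath_iff, mul_inv_mul, mem_strongComponent_iff h.generates]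
  exact ⟨rfl, rfl⟩

/-- `SΓ(w_S)` is closed and contains the path of `w`. Conversely, a path `p` from `1` in it means
that `ww⁻¹p` is `ℛ`-related to `w`, which amounts to `ww⁻¹ ≤ pp⁻¹`; every closed graph containing
the path of `w` then contains that of `p`. -/
theorem closureOf_span (h : IsXGenEUnitary ιS ι φ) (w : Word X) :
    closureOf h (CSub.span ι 1 w) = schutzenberger h (wordVal ιS w) := by
  apply le_antisymm
  · exact ClosureOperator.closure_min (schutzenbergerSubgr_hasPath_self h w).2
      (schutzenberger_relClosed h _)
  · refine (schutzenberger h _).2.le_of_hasPath (schutzenbergerSubgr_hasPath_self h w).src ?_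
    intro p k hp
    obtain ⟨hk, hp⟩ := (schutzenbergerSubgr_one_hasPath_iff h).1 hp
    rw [mem_strongComponent_iff h.generates] at hp
    have hw : (closureOf h (CSub.span ι 1 w)).1.HasPath 1 w _ :=
      ⟨rfl, (closureOf h).le_closure (CSub.span ι 1 w)⟩
    refine RelClosed.hasPath_of_wordVal ((closureOf h).isClosed_closure _) hw
      (by rw [one_mul, hk]) ?_
    rw [mul_inv_rev', mul_inv_rev', inv_inv'] at hp
    have hc := idem_comm (idem_mul_inv (wordVal ιS w)) (idem_mul_inv (wordVal ιS p))
    have hi := idem_mul_inv (wordVal ιS w)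
    generalize wordVal ιS w * (wordVal ιS w)⁻¹ = e at *
    calc e * (wordVal ιS p * (wordVal ιS p)⁻¹)
        = e * e * (wordVal ιS p * (wordVal ιS p)⁻¹) := by rw [hi]
      _ = e * wordVal ιS p * ((wordVal ιS p)⁻¹ * e) := by
        rw [mul_assoc, hc]; simp only [mul_assoc]
      _ = e := hp

/-- A word for `s` labels a path from `1` in `SΓ(s) = SΓ(t)`, so `tt⁻¹s` is `ℛ`-related to `t`. It
is also `σ`-related to `t`, hence equal to it: `t ≤ s`, and by symmetry `s ≤ t`. -/
theorem eq_of_schutzenberger_eq (h : IsXGenEUnitary ιS ι φ) {s t : S}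
    (hΓ : schutzenberger h s = schutzenberger h t) (hφ : φ s = φ t) : s = t := by
  have key : ∀ s t : S, schutzenberger h s = schutzenberger h t → φ s = φ t →
      t * t⁻¹ * s = t := by
    intro s t hΓ hφ
    obtain ⟨w, rfl⟩ := exists_wordVal h.generates s
    have hp := schutzenbergerSubgr_hasPath_self h w
    rw [show schutzenbergerSubgr h (wordVal ιS w) = schutzenbergerSubgr h t from
      congrArg Subtype.val hΓ, schutzenbergerSubgr_one_hasPath_iff,
      mem_strongComponent_iff h.generates] at hp
    exact eq_of_mul_inv_eq h.eUnitary h.image hp.2 (by simp [map_inv', hφ])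
  have h1 := key s t hΓ hφ
  have h2 := key t s hΓ.symm hφ.symm
  calc s = s * s⁻¹ * (t * t⁻¹ * s) := by rw [h1, h2]
    _ = t * t⁻¹ * (s * s⁻¹ * s) := by
      rw [← mul_assoc, idem_comm (idem_mul_inv s) (idem_mul_inv t), mul_assoc]
    _ = t := by rw [mul_inv_mul, h1]

end monoid

/-! ### The inverse monoid `S_c` and its closed subgraphs -/

namespace MonoidOf

variable {ι : X → G} {c : ClosureOperator (CSub ι)} {hc : IsInvariant c}

theorem elt_wordVal (w : Word X) : (wordVal (gen c hc) w).elt = wordVal ι w :=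
  map_wordVal (φ := proj c hc) (fun _ => rfl) w

theorem graph_letterVal (a : Letter X) :
    (letterVal (gen c hc) a).graph = c (CSub.span ι 1 [a]) := by
  obtain ⟨x, _ | _⟩ := a
  -- The inverse of a generator carries the translate by `x⁻¹` of the edge `x`, which is the edge
  -- `x⁻¹` at `1` traversed backwards.
  · change (ι x)⁻¹ • c (CSub.span ι 1 [(x, true)]) = _
    rw [← hc, CSub.smul_span, mul_one]
    congr 1
    apply Subtype.ext
    change Subgr.span ι (ι x)⁻¹ [(x, true)] = Subgr.span ι 1 [(x, false)]
    apply le_antisymm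
    · have hp : (Subgr.span ι 1 [(x, false)]).HasPath 1 [(x, false)] (ι x)⁻¹ :=
        ⟨by simp [letterVal], le_rfl⟩
      simpa [Word.inv, Letter.flip] using hp.inv.2
    · have hp : (Subgr.span ι (ι x)⁻¹ [(x, true)]).HasPath (ι x)⁻¹ [(x, true)] 1 :=
        ⟨by simp [letterVal], le_rfl⟩
      simpa [Word.inv, Letter.flip] using hp.inv.2
  · rfl

/-- Closed graphs are compared through their closed upper bounds, where the nested closures in a
product disappear and only the union of the edges of the path remains. -/
theorem graph_wordVal (w : Word X) : (wordVal (gen c hc) w).graph = c (CSub.span ι 1 w) := by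
  have key : ∀ Δ, c.IsClosed Δ →
      ((wordVal (gen c hc) w).graph ≤ Δ ↔ CSub.span ι 1 w ≤ Δ) := by
    induction w with
    | nil => exact fun Δ hΔ => (graph_one_le hΔ).trans Subgr.single_le.symm
    | cons a w ih =>
      intro Δ hΔ
      have helt : (letterVal (gen c hc) a).elt = letterVal ι a :=
        map_letterVal (φ := proj c hc) (fun _ => rfl) a
      rw [wordVal_cons, graph_mul_le hΔ, ih _ (isClosed_smul hc hΔ _), graph_letterVal,
        ClosureOperator.IsClosed.closure_le_iff hΔ, ← CSub.smul_le_iff, CSub.smul_span, helt,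
        mul_one]
      change Subgr.span ι 1 [a] ≤ Δ.1 ∧ _ ↔ Subgr.span ι 1 ([a] ++ w) ≤ Δ.1
      rw [Subgr.span_append, sup_le_iff]
      simp [CSub.span, ← Subtype.coe_le_coe]
  exact le_antisymm ((key _ (c.isClosed_closure _)).2 (c.le_closure _))
    (ClosureOperator.closure_min ((key _ (wordVal (gen c hc) w).compact.isClosed).1 le_rfl)
      (wordVal (gen c hc) w).compact.isClosed)

theorem exists_wordVal_gen (a : MonoidOf c hc) : ∃ w, wordVal (gen c hc) w = a := by
  obtain ⟨F, hF, hFa, h1⟩ := a.compact.exists_mem a.one_mem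
  obtain ⟨w, hw, hspan⟩ := F.2.exists_span_eq hF h1 h1
  -- The closed walk `w` at `1` spans a finite generating graph; the detour `u` to the group
  -- component stays inside the closure and so does not enlarge it.
  obtain ⟨u, hu⟩ := a.graph.2.2 1 a.one_mem _ a.elt_mem
  have hw' : a.graph.1.HasPath 1 w 1 := hw.mono (hFa ▸ c.le_closure F)
  have hp := hw'.trans hu
  refine ⟨w ++ u, MonoidOf.ext ?_ ?_⟩
  · rw [graph_wordVal]
    refine le_antisymm (ClosureOperator.closure_min hp.2 a.compact.isClosed) ?_
    rw [← hFa]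
    refine c.monotone ?_
    change F.1 ≤ Subgr.span ι 1 (w ++ u)
    rw [Subgr.span_append, hspan]
    exact le_sup_left
  · rw [elt_wordVal]
    simpa using hp.1

theorem generates_gen : Generates (gen c hc) := by
  intro T hT hinv s
  obtain ⟨w, rfl⟩ := exists_wordVal_gen s
  induction w with
  | nil => exact T.one_mem
  | cons a w ih =>
    rw [wordVal_cons]
    refine T.mul_mem ?_ ih
    obtain ⟨x, _ | _⟩ := a
    · exact hinv _ (hT x)
    · exact hT x

theorem sigma_iff {s t : MonoidOf c hc} : Sigma s t ↔ s.elt = t.elt := by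
  constructor
  · rintro ⟨e, -, h⟩
    simpa using congrArg elt h
  · intro h
    -- The graph of this idempotent is the closure of the union of both graphs. It absorbs the graph
    -- of `s` and that of `t`, so only the common group component remains.
    refine ⟨s * s⁻¹ * (t * t⁻¹), idem_mul (idem_mul_inv s) (idem_mul_inv t), ?_⟩
    refine ext_of (by simp [h]) fun Δ hΔ => ?_
    simp only [graph_mul_le hΔ, elt_mul, elt_inv, graph_inv,
      mul_inv_cancel, inv_one, one_smul, mul_one, CSub.smul_le_iff, inv_inv, smul_smul]
    tauto

theorem isIdempotentElem_iff {s : MonoidOf c hc} : IsIdempotentElem s ↔ s.elt = 1 := by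
  constructor
  · intro h
    simpa using congrArg elt h.eq
  · intro h
    refine ext_of (by simp [h]) fun Δ hΔ => ?_
    simp [graph_mul_le hΔ, h]

theorem isXGenEUnitary (hι : Subgroup.closure (Set.range ι) = ⊤) :
    IsXGenEUnitary (gen c hc) ι (proj c hc) where
  generates := generates_gen
  eUnitary s := by rw [sigma_iff, isIdempotentElem_iff, elt_one]
  image := by
    refine ⟨fun g => ?_, fun s t => sigma_iff.symm⟩
    have hg : g ∈ Subgroup.closure (Set.range ι) := hι ▸ Subgroup.mem_top g
    induction hg using Subgroup.closure_induction with
    | mem _ hx => obtain ⟨x, rfl⟩ := hx; exact ⟨gen c hc x, rfl⟩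
    | one => exact ⟨1, rfl⟩
    | mul _ _ _ _ h1 h2 =>
      obtain ⟨⟨a, rfl⟩, ⟨b, rfl⟩⟩ := And.intro h1 h2
      exact ⟨a * b, map_mul _ _ _⟩
    | inv _ _ h1 => obtain ⟨a, rfl⟩ := h1; exact ⟨a⁻¹, rfl⟩
  canonical _ := rfl

/-- A closed graph sees a word only through the graph component of its value in `S_c`, so words of
equal value label the same paths. -/
theorem span_le_iff {Δ : CSub ι} (hΔ : c.IsClosed Δ) (g : G) (w : Word X) :
    Subgr.span ι g w ≤ Δ.1 ↔ (wordVal (gen c hc) w).graph ≤ g⁻¹ • Δ := by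
  rw [graph_wordVal, ClosureOperator.IsClosed.closure_le_iff (isClosed_smul hc hΔ _),
    ← CSub.smul_le_iff, CSub.smul_span, mul_one]
  exact Iff.rfl

theorem relClosed_of_isClosed {Δ : CSub ι} (hΔ : c.IsClosed Δ) :
    RelClosed (fun u v => wordVal (gen c hc) u = wordVal (gen c hc) v) Δ := by
  intro u v huv g _ k _
  simp only [Subgr.HasPath]
  rw [span_le_iff (hc := hc) hΔ, span_le_iff (hc := hc) hΔ, ← elt_wordVal (c := c) (hc := hc), huv,
    elt_wordVal]

theorem isClosed_of_relClosed (hfin : IsFinitary c) {Δ : CSub ι}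
    (hΔ : RelClosed (fun u v => wordVal (gen c hc) u = wordVal (gen c hc) v) Δ) :
    c.IsClosed Δ := by
  have key : ∀ F : CSub ι, F ≤ Δ → F.1.IsFinite → c F ≤ Δ := by
    intro F hF hFfin
    obtain ⟨g, hg⟩ := F.2.1
    obtain ⟨w, hw, hspan⟩ := F.2.exists_span_eq hFfin hg hg
    refine (c F).2.le_of_hasPath ((c.le_closure F).1 hg) fun p k hp => ?_
    refine hΔ.hasPath_of_wordVal (hw.mono hF) hp.1 ?_
    -- Since `F` is the path of `w` from `g`, invariance turns `F^c` into the `g`-translate of the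
    -- graph of `w`; as `p` runs inside `F^c`, its graph is contained in that of `w`.
    have hle : (wordVal (gen c hc) p).graph ≤ (wordVal (gen c hc) w).graph := by
      have h1 := (span_le_iff (hc := hc) (c.isClosed_closure F) g p).1 hp.2
      have h2 : F = CSub.span ι g w := Subtype.ext hspan.symm
      rwa [h2, ← hc, CSub.smul_span, inv_mul_cancel, ← graph_wordVal (hc := hc)] at h1
    generalize wordVal (gen c hc) p = s at *
    generalize wordVal (gen c hc) w = t at *
    refine ext_of (by simp) fun Ω hΩ => ?_
    simp only [graph_mul_le hΩ, elt_mul, elt_inv,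
      graph_inv, mul_inv_cancel, inv_one, one_smul, CSub.smul_le_iff, inv_inv, smul_smul, and_self]
    exact ⟨fun h => h.1, fun h => ⟨h, hle.trans h⟩⟩
  -- Finitarity reduces the closure of `Δ` to the closures of its finite connected subgraphs.
  rw [c.isClosed_iff]
  refine le_antisymm (show (c Δ).1 ≤ Δ.1 from ⟨?_, ?_⟩) (c.le_closure Δ)
  · rw [(hfin Δ).1]
    exact Set.iUnion₂_subset fun F hF => (key F hF.1 hF.2).1
  · rw [(hfin Δ).2]
    exact Set.iUnion₂_subset fun F hF => (key F hF.1 hF.2).2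

theorem eq_closureOf (hfin : IsFinitary c)
    (h : IsXGenEUnitary (gen c hc) ι (proj c hc)) : c = closureOf h :=
  ClosureOperator.ext_isClosed _ _ fun _ =>
    ⟨fun hΔ => relClosed_of_isClosed (hc := hc) hΔ, fun hΔ => isClosed_of_relClosed hfin hΔ⟩

end MonoidOf

/-! ### The isomorphism of `S` with the monoid of its closure operator -/

section monoid

variable {S : Type*} [InverseMonoid S] {ιS : X → S} {ι : X → G} {φ : S →* G}

theorem one_mem_schutzenberger (h : IsXGenEUnitary ιS ι φ) (s : S) :
    (1 : G) ∈ (schutzenberger h s).1.verts :=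
  ⟨_, mul_inv_mem_strongComponent h.generates s, by simp [map_inv']⟩

/-- The map `s ↦ (SΓ(s), sσ)`. -/
def toMonoidOf (h : IsXGenEUnitary ιS ι φ) (s : S) :
    MonoidOf (closureOf h) (closureOf_invariant h) where
  graph := schutzenberger h s
  elt := φ s
  compact := by
    obtain ⟨w, rfl⟩ := exists_wordVal h.generates s
    exact ⟨_, Subgr.isFinite_span 1 w, closureOf_span h w⟩
  one_mem := one_mem_schutzenberger h s
  elt_mem := ⟨s, (mem_strongComponent_iff h.generates).2 rfl, rfl⟩

/-- This is the source of surjectivity, multiplicativity and canonicity: each is checked on words,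
which represent all elements on both sides. -/
theorem toMonoidOf_wordVal (h : IsXGenEUnitary ιS ι φ) (w : Word X) :
    toMonoidOf h (wordVal ιS w) = wordVal (MonoidOf.gen _ (closureOf_invariant h)) w := by
  refine MonoidOf.ext ?_ ?_
  · rw [MonoidOf.graph_wordVal, closureOf_span]
    rfl
  · rw [MonoidOf.elt_wordVal]
    exact map_wordVal h.canonical w

theorem toMonoidOf_bijective (h : IsXGenEUnitary ιS ι φ) : Function.Bijective (toMonoidOf h) := by
  refine ⟨fun s t hst => eq_of_schutzenberger_eq h (congrArg MonoidOf.graph hst)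
    (congrArg MonoidOf.elt hst), fun a => ?_⟩
  obtain ⟨w, rfl⟩ := MonoidOf.exists_wordVal_gen a
  exact ⟨_, toMonoidOf_wordVal h w⟩

theorem toMonoidOf_mul (h : IsXGenEUnitary ιS ι φ) (s t : S) :
    toMonoidOf h (s * t) = toMonoidOf h s * toMonoidOf h t := by
  obtain ⟨u, rfl⟩ := exists_wordVal h.generates s
  obtain ⟨v, rfl⟩ := exists_wordVal h.generates t
  rw [← wordVal_append, toMonoidOf_wordVal, toMonoidOf_wordVal, toMonoidOf_wordVal,
    wordVal_append]

theorem toMonoidOf_gen (h : IsXGenEUnitary ιS ι φ) (x : X) :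
    toMonoidOf h (ιS x) = MonoidOf.gen _ (closureOf_invariant h) x := by
  simpa [letterVal] using toMonoidOf_wordVal h [(x, true)]

end monoid

end XGraph

open XGraph in
theorem mainTheorem3 :
    (∀ {X S G : Type*} [InverseMonoid S] [Group G] (ιS : X → S) (ι : X → G) (φ : S →* G)
      (h : IsXGenEUnitary ιS ι φ),
      ∃ ψ : S ≃* MonoidOf (closureOf h) (closureOf_invariant h),
        (∀ s, (ψ s).graph = schutzenberger h s ∧ (ψ s).elt = φ s) ∧
        (∀ s, ψ s⁻¹ = (ψ s)⁻¹) ∧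
        (∀ x, ψ (ιS x) = MonoidOf.gen (closureOf h) (closureOf_invariant h) x)) ∧
    (∀ {X G : Type*} [Group G] (ι : X → G), Subgroup.closure (Set.range ι) = ⊤ →
      ∀ (c : ClosureOperator (CSub ι)) (hc : IsInvariant c), IsFinitary c →
        ∃ h : IsXGenEUnitary (MonoidOf.gen c hc) ι (MonoidOf.proj c hc),
          c = closureOf h) := by
  refine ⟨fun ιS ι φ h => ?_, fun ι hι c hc hfin => ?_⟩
  · let ψ := MulEquiv.ofBijective (⟨toMonoidOf h, toMonoidOf_mul h⟩ : _ →ₙ* _)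
      (toMonoidOf_bijective h)
    -- Inverses are determined by the multiplication, so `ψ` preserves them automatically.
    exact ⟨ψ, fun s => ⟨rfl, rfl⟩, InverseMonoid.map_inv_of_monoidHom ψ, toMonoidOf_gen h⟩
  · exact ⟨MonoidOf.isXGenEUnitary hι, MonoidOf.eq_closureOf hfin _⟩
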